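/- Theorem (sample complexity of approximating a game). Let $G$ be a finite extensive-form game with perfect recall, with $N$ nodes (terminal and non-terminal), fix a player $i$, and suppose that $|u_i(z)| \le B$ for all terminal nodes $z$. Nature (player $0$) plays the true distribution $\sigma_0(\cdot|h)$ at each of its nodes $h$. At every nature node $h$, $n_h$ samples are drawn from $\sigma_0(\cdot|h)$, all samples being independent; the sample sizes $n_h$ are fixed in advance (more generally, $n_h$ may depend on the samples drawn at the proper ancestors of $h$). Let $\hat\sigma_0(\cdot|h)$ be the empirical distribution of the samples at $h$ (set to $0$ if $n_h=0$), and let $\hat\sigma_0(h)$ be nature's empirical reach probability of $h$, i.e. the product of the probabilities $\hat\sigma_0(a|g)$ over all nature nodes $g$ that precede $h$, where $a$ is the action at $g$ that leads to $h$. For a profile $\sigma$ of behavior strategies let $u_i(\sigma)$ and $\hat u_i(\sigma)$ be the expected utility of player $i$ when the players play $\sigma$ and nature plays $\sigma_0$, respectively $\hat\sigma_0$. The perfect-information refinement of $G$ is the game with the same tree, payoffs and nature distributions in which every information set is a singleton; let $D$ be the maximum, over the pure strategy profiles of this refinement, of the number of terminal nodes that are reached with positive probability when nature plays $\sigma_0$.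 Let $\varepsilon > 0$ and $\delta > 0$. Then, with probability at least $1-\delta$ over the samples, the following holds: if $$ n_h \;\ge\; \hat\sigma_0(h)\, \frac{B^2 D^2}{2\varepsilon^2}\, \log\frac{2N}{\delta} \qquad\text{for every nature node } h, $$ then $|u_i(\sigma) - \hat u_i(\sigma)| \le \varepsilon$ for every behavior strategy profile $\sigma$ of $G$. In particular, for payoffs in $[0,1]$ or $[-1,1]$ one can take $B=1$, and if the sample sizes always satisfy the displayed condition, then with probability at least $1-\delta$ all utilities are within $\varepsilon$. -/

import Mathlib

open MeasureTheory ProbabilityTheory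

/-! ### Finite extensive-form games

A history is the list of the actions taken since the initial state, most recent action first, so
that `[]` is the root, and the child of `h` along the edge labelled `a` is `a :: h`. The proper
ancestors of `h` are then its proper suffixes. -/

/-- The labels of the edges that leave `h` in the tree with node set `nodes`. -/
noncomputable def actionsAt {A : Type*} (nodes : Finset (List A)) (h : List A) : Finset A :=
  nodes.preimage (fun a => a :: h) (fun _ _ _ _ e => (List.cons.inj e).1)

/-- `p` is a probability distribution on the finite set `S`. -/
def IsDistributionOn {A : Type*} (S : Finset A) (p : A → ℝ) : Prop :=
  (∀ a, 0 ≤ p a) ∧ (∀ a, a ∉ S → p a = 0) ∧ ∑ a ∈ S, p a = 1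

open Classical in
/-- The sequence of player `i` at a history: the information sets observed and the actions taken by
player `i` on the path from the root, most recent first. -/
noncomputable def playerSequence {ι J A : Type*} (player : List A → Option ι) (info : List A → J)
    (i : ι) : List A → List (J × A)
  | [] => []
  | a :: h =>
    if player h = some i then (info h, a) :: playerSequence player info i h
    else playerSequence player info i h

/-- A finite extensive-form game with perfect recall; `ι` is the set of players, `A` contains the
actions and `J` the names of the information sets. -/
structure ExtensiveGame (ι J A : Type*) where
  /-- the finite tree of histories -/
  nodes : Finset (List A)
  root_mem : [] ∈ nodes
  parent_mem : ∀ a h, a :: h ∈ nodes → h ∈ nodes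
  /-- the player who acts at a node; `none` stands for nature -/
  player : List A → Option ι
  /-- the payoffs (relevant at the terminal nodes only) -/
  utility : ι → List A → ℝ
  /-- the name of the information set of a decision node: two decision nodes of the same player lie
  in the same information set iff they carry the same name -/
  info : List A → J
  actions_eq : ∀ i, ∀ h ∈ nodes, ∀ h' ∈ nodes,
    (actionsAt nodes h).Nonempty → (actionsAt nodes h').Nonempty →
    player h = some i → player h' = some i → info h = info h' →
    actionsAt nodes h = actionsAt nodes h'
  perfect_recall : ∀ i, ∀ h ∈ nodes, ∀ h' ∈ nodes,
    (actionsAt nodes h).Nonempty → (actionsAt nodes h').Nonempty →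
    player h = some i → player h' = some i → info h = info h' →
    playerSequence player info i h = playerSequence player info i h'
  /-- `nature h a` is the probability that nature chooses the action `a` at its node `h` -/
  nature : List A → A → ℝ
  nature_dist : ∀ h ∈ nodes, (actionsAt nodes h).Nonempty → player h = none →
    IsDistributionOn (actionsAt nodes h) (nature h)

namespace ExtensiveGame

variable {ι J A : Type*}

/-- The actions available at `h`. -/
noncomputable def actions (G : ExtensiveGame ι J A) (h : List A) : Finset A := actionsAt G.nodes h

open Classical in
/-- The terminal nodes: the leaves of the tree. -/
noncomputable def terminals (G : ExtensiveGame ι J A) : Finset (List A) :=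
  G.nodes.filter fun z => G.actions z = ∅

/-- `h` is a node at which nature acts. -/
def IsNatureNode (G : ExtensiveGame ι J A) (h : List A) : Prop :=
  h ∈ G.nodes ∧ (G.actions h).Nonempty ∧ G.player h = none

/-- `h` is a decision node of player `i`. -/
def IsDecisionNode (G : ExtensiveGame ι J A) (i : ι) (h : List A) : Prop :=
  h ∈ G.nodes ∧ (G.actions h).Nonempty ∧ G.player h = some i

/-- `σ` is a profile of behavior strategies: `σ i I` is a distribution on the actions available at
the information set `I` of player `i`. (The values of `σ i` at names that do not belong to an
information set of player `i` are irrelevant.) -/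
def IsProfile (G : ExtensiveGame ι J A) (σ : ι → J → A → ℝ) : Prop :=
  ∀ i h, G.IsDecisionNode i h → IsDistributionOn (G.actions h) (σ i (G.info h))

/-- A pure strategy profile: one action is chosen with certainty at each information set. -/
def IsPureProfile (G : ExtensiveGame ι J A) (σ : ι → J → A → ℝ) : Prop :=
  G.IsProfile σ ∧ ∀ i h, G.IsDecisionNode i h → ∃ a, σ i (G.info h) a = 1

/-- The product of the numbers `q h a` over the edges `(h, a)` of the path from the root. -/
def pathProd (q : List A → A → ℝ) : List A → ℝ
  | [] => 1
  | a :: h => pathProd q h * q h a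

/-- The probability that `a` is chosen at `h` if nature plays `p` and the players play `σ`. -/
def moveProb (G : ExtensiveGame ι J A) (p : List A → A → ℝ) (σ : ι → J → A → ℝ)
    (h : List A) (a : A) : ℝ :=
  match G.player h with
  | none => p h a
  | some i => σ i (G.info h) a

/-- The probability that `h` is reached if nature plays `p` and the players play `σ`. -/
def reachProb (G : ExtensiveGame ι J A) (p : List A → A → ℝ) (σ : ι → J → A → ℝ)
    (h : List A) : ℝ :=
  pathProd (G.moveProb p σ) h

/-- Nature's own reach probability of `h`: the probability that `h` is reached if nature plays `p`
and all the players choose the actions that lead to `h`. -/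
def natureReach (G : ExtensiveGame ι J A) (p : List A → A → ℝ) (h : List A) : ℝ :=
  pathProd (fun g a => match G.player g with
    | none => p g a
    | some _ => 1) h

/-- The expected utility of player `i` if nature plays `p` and the players play `σ`. -/
noncomputable def value (G : ExtensiveGame ι J A) (p : List A → A → ℝ) (i : ι)
    (σ : ι → J → A → ℝ) : ℝ :=
  ∑ z ∈ G.terminals, G.reachProb p σ z * G.utility i z

/-- The perfect-information refinement: the same game, but every information set is a singleton. -/
def perfectInfo (G : ExtensiveGame ι J A) : ExtensiveGame ι (List A) A where
  nodes := G.nodes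
  root_mem := G.root_mem
  parent_mem := G.parent_mem
  player := G.player
  utility := G.utility
  info := fun h => h
  actions_eq := fun _ _ _ _ _ _ _ _ _ e => congrArg _ e
  perfect_recall := fun _ _ _ _ _ _ _ _ _ e => congrArg _ e
  nature := G.nature
  nature_dist := G.nature_dist

open Classical in
/-- The terminal nodes that are reached with positive probability under the profile `σ`. -/
noncomputable def terminalSupport (G : ExtensiveGame ι J A) (σ : ι → J → A → ℝ) :
    Finset (List A) :=
  G.terminals.filter fun z => 0 < G.reachProb G.nature σ z

/-- The maximum number of terminal nodes in the support of a pure strategy profile in the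
perfect-information refinement of `G`. -/
noncomputable def maxSupport (G : ExtensiveGame ι J A) : ℕ :=
  sSup {d | ∃ s : ι → List A → A → ℝ,
    G.perfectInfo.IsPureProfile s ∧ d = (G.perfectInfo.terminalSupport s).card}

/-- `X h 0, X h 1, …` is the stream of samples available at the nature node `h`, and the first `n h`
of them are drawn. All samples are independent, and those at `h` are distributed according to
nature's true distribution at `h`. The number `n h` may be a constant; more generally it may depend
on the samples at those nature nodes that are proper ancestors of `h`. -/
structure IsNatureSampling (G : ExtensiveGame ι J A) [MeasurableSpace A]
    {Ω : Type*} [MeasurableSpace Ω] (μ : Measure Ω)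
    (X : List A → ℕ → Ω → A) (n : List A → Ω → ℕ) : Prop where
  measurable : ∀ h, G.IsNatureNode h → ∀ k, Measurable (X h k)
  law : ∀ h, G.IsNatureNode h → ∀ k a, μ.real {ω | X h k ω = a} = G.nature h a
  indep : iIndepFun (fun q : {h // G.IsNatureNode h} × ℕ => X q.1 q.2) μ
  size_measurable : ∀ h, G.IsNatureNode h →
    Measurable[⨆ q : {g // G.IsNatureNode g ∧ g <:+ h ∧ g ≠ h} × ℕ,
      MeasurableSpace.comap (X q.1 q.2) inferInstance] (n h)

end ExtensiveGame

open Classical in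
/-- The empirical nature strategy: `empiricalNature X n ω h a` is the relative frequency of the
action `a` among the first `n h ω` samples at `h` (and `0` if there are none). -/
noncomputable def empiricalNature {A Ω : Type*} (X : List A → ℕ → Ω → A) (n : List A → Ω → ℕ)
    (ω : Ω) (h : List A) (a : A) : ℝ :=
  (((Finset.range (n h ω)).filter fun k => X h k ω = a).card : ℝ) / (n h ω : ℝ)

/-!
# Sample complexity of approximating a game

For a node `h` let `ρ h` be nature's true reach probability and `M h` its empirical one, and let
`C = B² D² / (2 ε²) · log (2 N / δ)`. The hypothesis on the sample sizes reads `C * M h ≤ n h`.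

*One path.* Along the path to a node `z`, `M` is multiplied at every nature node `h` by an average
of `n h ≥ C * M h` Bernoulli variables. Conditionally on the past, such an average scaled by `M h`
has a smaller moment generating function than `1 / C` times a binomial variable with `C * M h`
trials (a real number of trials: the power `(1 - p + p * t) ^ (C * M h)`); this is concavity of
powers with exponent at most one (`bernoulli_pow_le_rpow`, `lintegral_sampling_step`). Since the
maps `t ↦ 1 - p + p * t` compose to a map of the same form with the product of the probabilities,
induction on the path gives `𝔼[t ^ (C * M z)] ≤ (1 - ρ z + ρ z * t) ^ C`, the expectation being
restricted to the event that the sample sizes on the path suffice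
(`ExtensiveGame.IsNatureSampling.lintegral_rpow_natureReach_le`). So `M z` concentrates about `ρ z`
as an average of `C` independent Bernoulli variables would, however long the path is. Hoeffding's
lemma bounds the probability of a deviation of at least `ε / (B D)` by `δ / N`, and a union bound
over the terminal nodes leaves a failure probability of at most `δ`.

*From paths to utilities.* Almost surely `M z = 0` whenever `ρ z = 0`, so the error in the utility
is at most the sum of `|ρ z - M z| * B`, weighted by the probability that the players choose the
actions leading to `z`, over the terminal nodes `z` in the support of nature
(`ExtensiveGame.abs_value_sub_value_le`). For a pure profile of the perfect-information refinement
these weights count the support of the profile. By backward induction their sum is largest at a pure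
profile, hence is at most `D`
(`ExtensiveGame.sum_reachProb_natureSupport_le_maxSupport`).
-/

namespace ExtensiveGame

variable {ι J A : Type*}

/-! ### Sums over the tree -/

lemma mem_actions {G : ExtensiveGame ι J A} {h : List A} {a : A} :
    a ∈ G.actions h ↔ a :: h ∈ G.nodes :=
  Finset.mem_preimage (hf := fun _ _ _ _ e => (List.cons.inj e).1)

lemma mem_terminals {G : ExtensiveGame ι J A} {z : List A} :
    z ∈ G.terminals ↔ z ∈ G.nodes ∧ G.actions z = ∅ := by
  classical
  simp [terminals]

lemma sum_nodes (G : ExtensiveGame ι J A) (f : List A → ℝ) :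
    ∑ h ∈ G.nodes, f h = f [] + ∑ h ∈ G.nodes, ∑ a ∈ G.actions h, f (a :: h) := by
  classical
  rw [← Finset.add_sum_erase _ _ G.root_mem, Finset.sum_sigma']
  congr 1
  symm
  refine Finset.sum_bij (fun x _ => x.2 :: x.1) ?_ ?_ ?_ ?_
  · rintro ⟨h, a⟩ hx
    simp only [Finset.mem_sigma, mem_actions] at hx
    simp [hx.2]
  · rintro ⟨h, a⟩ _ ⟨h', a'⟩ _ e
    simp only [List.cons.injEq] at e
    rw [e.1, e.2]
  · rintro (_ | ⟨a, h⟩) hx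
    · simp at hx
    · have hx' := Finset.mem_of_mem_erase hx
      exact ⟨⟨h, a⟩, by simp [mem_actions, hx', G.parent_mem a h hx'], rfl⟩
  · intros
    rfl

/-- Telescoping along the tree: the potential `W`, weighted by path products, changes from the root
to the leaves by the sum of its one-step changes. -/
lemma sum_terminals_pathProd_mul (G : ExtensiveGame ι J A) (q : List A → A → ℝ)
    (W : List A → ℝ) :
    ∑ z ∈ G.terminals, pathProd q z * W z =
      W [] + ∑ h ∈ G.nodes with (G.actions h).Nonempty,
        pathProd q h * (∑ a ∈ G.actions h, q h a * W (a :: h) - W h) := by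
  classical
  have h1 := G.sum_nodes fun h => pathProd q h * W h
  have h2 := Finset.sum_filter_add_sum_filter_not G.nodes (fun h => G.actions h = ∅)
    fun h => pathProd q h * W h
  have h3 : ∑ h ∈ G.nodes, ∑ a ∈ G.actions h, pathProd q (a :: h) * W (a :: h) =
      ∑ h ∈ G.nodes with (G.actions h).Nonempty,
        pathProd q h * ∑ a ∈ G.actions h, q h a * W (a :: h) := by
    rw [Finset.sum_filter]
    refine Finset.sum_congr rfl fun h _ => ?_
    split_ifs with hne
    · rw [Finset.mul_sum]
      exact Finset.sum_congr rfl fun a _ => by simp only [pathProd]; ring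
    · rw [Finset.not_nonempty_iff_eq_empty.1 hne, Finset.sum_empty]
  simp only [← Finset.nonempty_iff_ne_empty] at h2
  simp only [mul_sub, Finset.sum_sub_distrib]
  rw [h3] at h1
  have h4 : pathProd q [] = 1 := rfl
  rw [h4, one_mul] at h1
  have h5 : ∑ z ∈ G.terminals, pathProd q z * W z =
    ∑ h ∈ G.nodes with G.actions h = ∅, pathProd q h * W h := by
    rw [terminals]
  linarith

lemma isNatureNode_of_cons {G : ExtensiveGame ι J A} {a : A} {h : List A} (hz : a :: h ∈ G.nodes)
    (hp : G.player h = none) : G.IsNatureNode h :=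
  ⟨G.parent_mem a h hz, ⟨a, mem_actions.2 hz⟩, hp⟩

lemma IsNatureNode.isDistributionOn {G : ExtensiveGame ι J A} {h : List A}
    (hh : G.IsNatureNode h) : IsDistributionOn (G.actions h) (G.nature h) :=
  G.nature_dist h hh.1 hh.2.1 hh.2.2

lemma IsNatureNode.nature_le_one {G : ExtensiveGame ι J A} {h : List A}
    (hh : G.IsNatureNode h) (a : A) : G.nature h a ≤ 1 := by
  obtain ⟨h0, hout, hsum⟩ := hh.isDistributionOn
  by_cases ha : a ∈ G.actions h
  · rw [← hsum]
    exact Finset.single_le_sum (fun b _ => h0 b) ha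
  · rw [hout a ha]
    exact zero_le_one

lemma natureReach_cons_none {G : ExtensiveGame ι J A} {h : List A} (hp : G.player h = none)
    (p : List A → A → ℝ) (a : A) :
    G.natureReach p (a :: h) = G.natureReach p h * p h a := by
  simp [natureReach, pathProd, hp]

lemma natureReach_cons_some {G : ExtensiveGame ι J A} {h : List A} {i : ι}
    (hp : G.player h = some i) (p : List A → A → ℝ) (a : A) :
    G.natureReach p (a :: h) = G.natureReach p h := by
  simp [natureReach, pathProd, hp]

lemma natureReach_nonneg {G : ExtensiveGame ι J A} {p : List A → A → ℝ}
    (hp : ∀ h a, G.IsNatureNode h → 0 ≤ p h a) {h : List A} (hh : h ∈ G.nodes) :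
    0 ≤ G.natureReach p h := by
  induction h with
  | nil => exact zero_le_one
  | cons a h ih =>
    have ih := ih (G.parent_mem a h hh)
    cases hpl : G.player h with
    | none =>
      rw [natureReach_cons_none hpl]
      exact mul_nonneg ih (hp h a (isNatureNode_of_cons hh hpl))
    | some i => rwa [natureReach_cons_some hpl]

lemma natureReach_le_one {G : ExtensiveGame ι J A} {h : List A} (hh : h ∈ G.nodes) :
    G.natureReach G.nature h ≤ 1 := by
  induction h with
  | nil => exact le_rfl
  | cons a h ih =>
    have hp := G.parent_mem a h hh
    have ih := ih hp
    cases hpl : G.player h with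
    | none =>
      rw [natureReach_cons_none hpl]
      have hn := isNatureNode_of_cons hh hpl
      exact mul_le_one₀ ih (hn.isDistributionOn.1 a) (hn.nature_le_one a)
    | some i => rwa [natureReach_cons_some hpl]

lemma reachProb_eq_natureReach_mul (G : ExtensiveGame ι J A) (p : List A → A → ℝ)
    (σ : ι → J → A → ℝ) (h : List A) :
    G.reachProb p σ h = G.natureReach p h * G.reachProb (fun _ _ => 1) σ h := by
  induction h with
  | nil => simp [reachProb, natureReach, pathProd]
  | cons a h ih =>
    simp only [reachProb, natureReach, pathProd] at ih ⊢
    rw [ih]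
    cases hpl : G.player h <;> simp only [moveProb, hpl] <;> ring

lemma reachProb_nonneg {G : ExtensiveGame ι J A} {p : List A → A → ℝ} {σ : ι → J → A → ℝ}
    (hp : ∀ h a, G.IsNatureNode h → 0 ≤ p h a) (hσ : G.IsProfile σ) {h : List A}
    (hh : h ∈ G.nodes) : 0 ≤ G.reachProb p σ h := by
  induction h with
  | nil => exact zero_le_one
  | cons a h ih =>
    have hpar := G.parent_mem a h hh
    refine mul_nonneg (ih hpar) ?_
    cases hpl : G.player h with
    | none =>
      simp only [moveProb, hpl]
      exact hp h a (isNatureNode_of_cons hh hpl)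
    | some i =>
      simp only [moveProb, hpl]
      exact (hσ i h ⟨hpar, ⟨a, mem_actions.2 hh⟩, hpl⟩).1 a

/-! ### The largest support of a pure strategy profile -/

open Classical in
/-- The moves that nature makes with positive probability, as a `0`-`1`-valued function. -/
noncomputable def natureSupport (G : ExtensiveGame ι J A) (h : List A) (a : A) : ℝ :=
  if 0 < G.nature h a then 1 else 0

lemma natureSupport_nonneg (G : ExtensiveGame ι J A) (h : List A) (a : A) :
    0 ≤ G.natureSupport h a := by
  unfold natureSupport
  split_ifs <;> norm_num

lemma natureReach_natureSupport {G : ExtensiveGame ι J A} {h : List A} (hh : h ∈ G.nodes)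
    (hpos : 0 < G.natureReach G.nature h) : G.natureReach G.natureSupport h = 1 := by
  induction h with
  | nil => rfl
  | cons a h ih =>
    have hpar := G.parent_mem a h hh
    cases hpl : G.player h with
    | none =>
      rw [natureReach_cons_none hpl] at hpos ⊢
      have hn := isNatureNode_of_cons hh hpl
      have h1 : 0 < G.nature h a := by
        refine (hn.isDistributionOn.1 a).lt_of_ne' fun e => ?_
        simp [e] at hpos
      have h2 := pos_of_mul_pos_left hpos h1.le
      rw [ih hpar h2, natureSupport, if_pos h1, one_mul]
    | some i =>
      rw [natureReach_cons_some hpl] at hpos ⊢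
      exact ih hpar hpos

open Classical in
/-- The largest number of leaves below `h` in the support of a pure strategy profile of the
perfect-information refinement, by backward induction to depth `k`. -/
noncomputable def maxLeaves (G : ExtensiveGame ι J A) : ℕ → List A → ℕ
  | 0, _ => 1
  | k + 1, h =>
    if G.actions h = ∅ then 1
    else match G.player h with
      | none => ∑ a ∈ G.actions h, if 0 < G.nature h a then maxLeaves G k (a :: h) else 0
      | some _ => (G.actions h).sup fun a => maxLeaves G k (a :: h)

/-- The largest length of a history. -/
noncomputable def depth (G : ExtensiveGame ι J A) : ℕ := G.nodes.sup List.length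

/-- `maxLeaves`, taken to the full depth of the tree. -/
noncomputable def leafValue (G : ExtensiveGame ι J A) (h : List A) : ℕ :=
  G.maxLeaves (G.depth - h.length) h

lemma leafValue_of_actions_eq_empty {G : ExtensiveGame ι J A} {h : List A}
    (hh : G.actions h = ∅) : G.leafValue h = 1 := by
  unfold leafValue
  cases G.depth - h.length <;> simp [maxLeaves, hh]

lemma depth_sub_length {G : ExtensiveGame ι J A} {h : List A} (hne : (G.actions h).Nonempty)
    (b : A) : G.depth - h.length = (G.depth - (b :: h).length) + 1 := by
  obtain ⟨a, ha⟩ := hne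
  have : (a :: h).length ≤ G.depth := Finset.le_sup (f := List.length) (mem_actions.1 ha)
  simp only [List.length_cons] at this ⊢
  omega

lemma leafValue_of_nature {G : ExtensiveGame ι J A} {h : List A} (hne : (G.actions h).Nonempty)
    (hpl : G.player h = none) :
    (G.leafValue h : ℝ) = ∑ a ∈ G.actions h, G.natureSupport h a * (G.leafValue (a :: h) : ℝ) := by
  have hd := depth_sub_length hne hne.choose
  rw [leafValue, hd, maxLeaves, if_neg hne.ne_empty, hpl]
  push_cast
  refine Finset.sum_congr rfl fun a _ => ?_
  rw [natureSupport, leafValue]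
  split_ifs <;> simp

lemma leafValue_of_player {G : ExtensiveGame ι J A} {h : List A} {i : ι}
    (hne : (G.actions h).Nonempty) (hpl : G.player h = some i) :
    G.leafValue h = (G.actions h).sup fun a => G.leafValue (a :: h) := by
  have hd := depth_sub_length hne hne.choose
  rw [leafValue, hd, maxLeaves, if_neg hne.ne_empty, hpl]
  rfl

/-- Backward induction: no behavior profile of the perfect-information refinement beats
`leafValue`. -/
lemma sum_reachProb_natureSupport_le_leafValue {G : ExtensiveGame ι J A}
    {s : ι → List A → A → ℝ} (hs : G.perfectInfo.IsProfile s) :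
    ∑ z ∈ G.terminals, G.perfectInfo.reachProb G.natureSupport s z ≤ (G.leafValue [] : ℝ) := by
  have key := G.sum_terminals_pathProd_mul (G.perfectInfo.moveProb G.natureSupport s)
    fun h => (G.leafValue h : ℝ)
  have hL : ∑ z ∈ G.terminals, G.perfectInfo.reachProb G.natureSupport s z =
      ∑ z ∈ G.terminals, pathProd (G.perfectInfo.moveProb G.natureSupport s) z *
        (G.leafValue z : ℝ) := by
    refine Finset.sum_congr rfl fun z hz => ?_
    rw [leafValue_of_actions_eq_empty (mem_terminals.1 hz).2]
    simp [reachProb]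
  rw [hL, key]
  refine add_le_of_nonpos_right (Finset.sum_nonpos fun h hh => ?_)
  obtain ⟨hh, hne⟩ := Finset.mem_filter.1 hh
  refine mul_nonpos_of_nonneg_of_nonpos
    (reachProb_nonneg (G := G.perfectInfo) (fun h a _ => G.natureSupport_nonneg h a) hs hh) ?_
  rw [sub_nonpos]
  cases hpl : G.player h with
  | none =>
    rw [leafValue_of_nature hne hpl]
    refine (Finset.sum_congr rfl fun a _ => ?_).le
    have : G.perfectInfo.player h = none := hpl
    simp only [moveProb, this]
  | some i =>
    have hpl' : G.perfectInfo.player h = some i := hpl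
    obtain ⟨h0, -, hsum⟩ := hs i h ⟨hh, hne, hpl'⟩
    calc ∑ a ∈ G.actions h, G.perfectInfo.moveProb G.natureSupport s h a *
            (G.leafValue (a :: h) : ℝ)
        ≤ ∑ a ∈ G.actions h, s i h a * (G.leafValue h : ℝ) := by
          refine Finset.sum_le_sum fun a ha => ?_
          simp only [moveProb, hpl']
          refine mul_le_mul_of_nonneg_left ?_ (h0 a)
          rw [leafValue_of_player hne hpl]
          exact_mod_cast Finset.le_sup (f := fun a => G.leafValue (a :: h)) ha
      _ = G.leafValue h := by
          rw [← Finset.sum_mul]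
          have : ∑ a ∈ G.actions h, s i h a = 1 := hsum
          rw [this, one_mul]

/-- The profile that moves to a child of maximal `leafValue` is pure and attains `leafValue`. -/
lemma leafValue_root_le_maxSupport (G : ExtensiveGame ι J A) :
    G.leafValue [] ≤ G.maxSupport := by
  classical
  have hex : ∀ h : List A, ∃ b : A → ℝ, (G.actions h).Nonempty →
      IsDistributionOn (G.actions h) b ∧ (∃ a, b a = 1) ∧ (∀ a, b a ≤ 1) ∧
      ∑ a ∈ G.actions h, b a * (G.leafValue (a :: h) : ℝ) =
        ((G.actions h).sup fun a => G.leafValue (a :: h) : ℕ) := by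
    intro h
    by_cases hne : (G.actions h).Nonempty
    · obtain ⟨c, hc, hmax⟩ := Finset.exists_mem_eq_sup _ hne fun a => G.leafValue (a :: h)
      refine ⟨fun a => if a = c then 1 else 0, fun _ => ⟨⟨fun a => ?_, fun a ha => ?_, ?_⟩, ⟨c, ?_⟩,
        fun a => ?_, ?_⟩⟩
      · dsimp only
        split_ifs <;> norm_num
      · refine if_neg ?_
        rintro rfl
        exact ha hc
      · simp [hc]
      · simp
      · dsimp only
        split_ifs <;> norm_num
      · simp [hc, hmax]
    · exact ⟨0, fun h => absurd h hne⟩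
  choose b hb using hex
  set s : ι → List A → A → ℝ := fun _ h => b h with hs
  have hprof : G.perfectInfo.IsProfile s := fun i h hh => (hb h hh.2.1).1
  have hpure : G.perfectInfo.IsPureProfile s := ⟨hprof, fun i h hh => (hb h hh.2.1).2.1⟩
  have key := G.sum_terminals_pathProd_mul (G.perfectInfo.moveProb G.natureSupport s)
    fun h => (G.leafValue h : ℝ)
  have hzero : ∑ h ∈ G.nodes with (G.actions h).Nonempty,
      pathProd (G.perfectInfo.moveProb G.natureSupport s) h *
        (∑ a ∈ G.actions h, G.perfectInfo.moveProb G.natureSupport s h a *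
          (G.leafValue (a :: h) : ℝ) - (G.leafValue h : ℝ)) = 0 := by
    refine Finset.sum_eq_zero fun h hh => ?_
    obtain ⟨hh, hne⟩ := Finset.mem_filter.1 hh
    rw [mul_eq_zero, sub_eq_zero]
    right
    cases hpl : G.player h with
    | none =>
      rw [leafValue_of_nature hne hpl]
      have : G.perfectInfo.player h = none := hpl
      simp only [moveProb, this]
    | some i =>
      have hpl' : G.perfectInfo.player h = some i := hpl
      simp only [moveProb, hpl']
      rw [leafValue_of_player hne hpl]
      exact (hb h hne).2.2.2
  rw [hzero, add_zero] at key
  have hbdd : BddAbove {d | ∃ s : ι → List A → A → ℝ,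
      G.perfectInfo.IsPureProfile s ∧ d = (G.perfectInfo.terminalSupport s).card} := by
    refine ⟨G.perfectInfo.terminals.card, ?_⟩
    rintro d ⟨s, -, rfl⟩
    exact Finset.card_le_card (Finset.filter_subset _ _)
  refine le_trans ?_ (le_csSup hbdd ⟨s, hpure, rfl⟩)
  -- A positive path product of numbers at most `1` counts at most once, and only on the support.
  have hpt : ∀ h ∈ G.nodes, pathProd (G.perfectInfo.moveProb G.natureSupport s) h ≤
      if 0 < G.perfectInfo.reachProb G.nature s h then 1 else 0 := by
    intro h
    induction h with
    | nil => simp [pathProd, reachProb]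
    | cons a h ih =>
      intro hh
      have hpar := G.parent_mem a h hh
      have hne : (G.actions h).Nonempty := ⟨a, mem_actions.2 hh⟩
      have ih := ih hpar
      have h0 : 0 ≤ pathProd (G.perfectInfo.moveProb G.natureSupport s) h :=
        reachProb_nonneg (G := G.perfectInfo) (fun h a _ => G.natureSupport_nonneg h a) hprof hpar
      have hm : 0 ≤ G.perfectInfo.moveProb G.natureSupport s h a ∧
          G.perfectInfo.moveProb G.natureSupport s h a ≤
            if 0 < G.perfectInfo.moveProb G.nature s h a then 1 else 0 := by
        cases hpl : G.player h with
        | none =>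
          have hpl' : G.perfectInfo.player h = none := hpl
          simp only [moveProb, hpl']
          exact ⟨G.natureSupport_nonneg h a, le_of_eq rfl⟩
        | some i =>
          have hpl' : G.perfectInfo.player h = some i := hpl
          simp only [moveProb, hpl']
          refine ⟨(hb h hne).1.1 a, ?_⟩
          split_ifs with hc
          · exact (hb h hne).2.2.1 a
          · exact not_lt.1 hc
      have hr : G.perfectInfo.reachProb G.nature s (a :: h) =
        G.perfectInfo.reachProb G.nature s h * G.perfectInfo.moveProb G.nature s h a := rfl
      rw [hr, pathProd]
      by_cases h1 : 0 < G.perfectInfo.reachProb G.nature s h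
      · by_cases h2 : 0 < G.perfectInfo.moveProb G.nature s h a
        · rw [if_pos (mul_pos h1 h2)]
          rw [if_pos h1] at ih
          rw [if_pos h2] at hm
          exact mul_le_one₀ ih hm.1 hm.2
        · rw [if_neg h2] at hm
          rw [le_antisymm hm.2 hm.1, mul_zero]
          split_ifs <;> norm_num
      · rw [if_neg h1] at ih
        rw [le_antisymm ih h0, zero_mul]
        split_ifs <;> norm_num
  have : (G.leafValue [] : ℝ) ≤ ((G.perfectInfo.terminalSupport s).card : ℝ) := by
    rw [← key, terminalSupport, Finset.card_filter]
    push_cast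
    refine Finset.sum_le_sum fun z hz => ?_
    obtain ⟨hz, hz'⟩ := mem_terminals.1 hz
    rw [leafValue_of_actions_eq_empty hz', Nat.cast_one, mul_one]
    exact hpt z hz
  exact_mod_cast this

/-- The weights with which the players reach the terminal nodes in the support of nature add up to
at most `maxSupport`, for every profile of behavior strategies. -/
lemma sum_reachProb_natureSupport_le_maxSupport {G : ExtensiveGame ι J A} {σ : ι → J → A → ℝ}
    (hσ : G.IsProfile σ) :
    ∑ z ∈ G.terminals, G.reachProb G.natureSupport σ z ≤ (G.maxSupport : ℝ) :=
  (sum_reachProb_natureSupport_le_leafValue (s := fun i h => σ i (G.info h)) hσ).trans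
    (by exact_mod_cast G.leafValue_root_le_maxSupport)

/-- If `p` charges no terminal node outside the support of nature, then replacing nature by `p`
changes the utilities by at most the sum of the changes at the terminal nodes in that support. -/
lemma abs_value_sub_value_le {G : ExtensiveGame ι J A} {p : List A → A → ℝ} {σ : ι → J → A → ℝ}
    (hσ : G.IsProfile σ) (i : ι)
    (hp : ∀ z ∈ G.terminals, G.natureReach G.nature z = 0 → G.natureReach p z = 0) :
    |G.value G.nature i σ - G.value p i σ| ≤
      ∑ z ∈ G.terminals, |G.natureReach G.nature z - G.natureReach p z| * |G.utility i z| *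
        G.reachProb G.natureSupport σ z := by
  rw [value, value, ← Finset.sum_sub_distrib]
  refine (Finset.abs_sum_le_sum_abs _ _).trans (Finset.sum_le_sum fun z hz => ?_)
  have hzn := (mem_terminals.1 hz).1
  have hone : 0 ≤ G.reachProb (fun _ _ => 1) σ z :=
    reachProb_nonneg (fun _ _ _ => zero_le_one) hσ hzn
  rw [G.reachProb_eq_natureReach_mul G.nature, G.reachProb_eq_natureReach_mul p,
    G.reachProb_eq_natureReach_mul G.natureSupport]
  rcases (natureReach_nonneg (fun h a hh => hh.isDistributionOn.1 a) hzn).eq_or_lt' with h0 | h0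
  · rw [h0, hp z hz h0]
    simp
  · rw [natureReach_natureSupport hzn h0, ← sub_mul, ← sub_mul, abs_mul, abs_mul,
      abs_of_nonneg hone]
    exact le_of_eq (by ring)

end ExtensiveGame

/-! ### Inequalities for Bernoulli variables -/

/-- An average of `m` Bernoulli variables with weight `x` is dominated by a binomial variable with
`C * x ≤ m` trials: this is concavity of `r ↦ t ^ r` in the exponent `C * x / m ≤ 1`. -/
lemma bernoulli_pow_le_rpow {p t C x : ℝ} {m : ℕ} (hp0 : 0 ≤ p) (hp1 : p ≤ 1) (ht : 0 < t)
    (hC : 0 ≤ C) (hx : 0 ≤ x) (hm : x * C ≤ m) :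
    (1 - p + p * t ^ (C * x / m)) ^ m ≤ (1 - p + p * t) ^ (C * x) := by
  have hq : 0 ≤ 1 - p := by linarith
  have hCx : 0 ≤ C * x := mul_nonneg hC hx
  rcases Nat.eq_zero_or_pos m with rfl | hmpos
  · have : C * x = 0 := le_antisymm (by simpa [mul_comm] using hm) hCx
    simp [this]
  have hm' : (0 : ℝ) < m := by exact_mod_cast hmpos
  have hr0 : 0 ≤ C * x / m := by positivity
  have hr1 : C * x / m ≤ 1 := by rw [div_le_one hm']; linarith
  have hj := (Real.concaveOn_rpow hr0 hr1).2 (x := 1) (y := t) (by simp) (by simp [ht.le]) hq hp0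
    (by ring)
  simp only [smul_eq_mul, Real.one_rpow, mul_one] at hj
  have hbase : 0 ≤ 1 - p + p * t := by positivity
  calc (1 - p + p * t ^ (C * x / m)) ^ m ≤ ((1 - p + p * t) ^ (C * x / m)) ^ m := by
        gcongr
    _ = (1 - p + p * t) ^ (C * x) := by
        rw [← Real.rpow_mul_natCast hbase, div_mul_cancel₀ _ hm'.ne']

/-- Hoeffding's lemma for a Bernoulli variable. -/
lemma bernoulli_mgf_le {p : ℝ} (hp0 : 0 ≤ p) (hp1 : p ≤ 1) (l : ℝ) :
    1 - p + p * Real.exp l ≤ Real.exp (l * p + l ^ 2 / 8) := by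
  set ν : Measure ℝ := ENNReal.ofReal (1 - p) • Measure.dirac 0 + ENNReal.ofReal p • Measure.dirac 1
    with hν
  have hq : 0 ≤ 1 - p := by linarith
  have hprob : IsProbabilityMeasure ν := by
    constructor
    simp only [hν, Measure.add_apply, Measure.smul_apply, measure_univ, smul_eq_mul, mul_one]
    rw [← ENNReal.ofReal_add hq hp0]
    simp
  have hint : ∀ f : ℝ → ℝ, ∫ x, f x ∂ν = (1 - p) * f 0 + p * f 1 := by
    intro f
    rw [hν, integral_add_measure, integral_smul_measure, integral_smul_measure, integral_dirac,
      integral_dirac, ENNReal.toReal_ofReal hq, ENNReal.toReal_ofReal hp0, smul_eq_mul, smul_eq_mul]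
    · exact (integrable_dirac (by simp)).smul_measure (by simp)
    · exact (integrable_dirac (by simp)).smul_measure (by simp)
  have hmem : ∀ᵐ x ∂ν, id x ∈ Set.Icc (0 : ℝ) 1 := by
    rw [hν, ae_add_measure_iff]
    constructor <;> refine Measure.ae_smul_measure ?_ _ <;> rw [ae_dirac_eq] <;> simp
  have hsub := (hasSubgaussianMGF_of_mem_Icc aemeasurable_id hmem).mgf_le l
  have hmean : ∫ x, id x ∂ν = p := by rw [hint]; simp
  rw [mgf, hint, hmean] at hsub
  have hc : (((‖(1 : ℝ) - 0‖₊ / 2) ^ 2 : NNReal) : ℝ) * l ^ 2 / 2 = l ^ 2 / 8 := by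
    simp
    ring
  rw [hc] at hsub
  calc 1 - p + p * Real.exp l
      = Real.exp (l * p) * ((1 - p) * Real.exp (l * (id 0 - p)) +
          p * Real.exp (l * (id 1 - p))) := by
        rw [mul_add, mul_left_comm, ← Real.exp_add, mul_left_comm, ← Real.exp_add]
        simp only [id]
        ring_nf
        simp
        ring
    _ ≤ Real.exp (l * p) * Real.exp (l ^ 2 / 8) := by gcongr
    _ = _ := (Real.exp_add _ _).symm

/-! ### One nature node -/

open Classical in
/-- The relative frequency of `a` among the first `m` entries of `v`. -/
noncomputable def sampleFreq {A : Type*} (a : A) (m : ℕ) (v : ℕ → A) : ℝ :=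
  (((Finset.range m).filter fun k => v k = a).card : ℝ) / (m : ℝ)

lemma empiricalNature_eq_sampleFreq {A Ω : Type*} (X : List A → ℕ → Ω → A) (n : List A → Ω → ℕ)
    (ω : Ω) (h : List A) (a : A) :
    empiricalNature X n ω h a = sampleFreq a (n h ω) fun k => X h k ω := rfl

lemma empiricalNature_nonneg {A Ω : Type*} (X : List A → ℕ → Ω → A) (n : List A → Ω → ℕ)
    (ω : Ω) (h : List A) (a : A) : 0 ≤ empiricalNature X n ω h a := by
  unfold empiricalNature
  positivity

section OneNode

variable {A Ω : Type*} [MeasurableSpace A] [MeasurableSingletonClass A] [MeasurableSpace Ω]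
  {μ : Measure Ω}

lemma measurable_sampleFreq {β : Type*} {_ : MeasurableSpace β} (a : A) {N : β → ℕ}
    {V : β → ℕ → A} (hN : Measurable N) (hV : Measurable V) :
    Measurable fun x => sampleFreq a (N x) (V x) := by
  classical
  suffices hs : Measurable fun u : ℕ × (ℕ → A) => sampleFreq a u.1 u.2 from
    hs.comp (f := fun x => (N x, V x)) (hN.prodMk hV)
  refine measurable_from_prod_countable_right fun m => ?_
  have : (fun v : ℕ → A => sampleFreq a (m, v).1 (m, v).2) = fun v : ℕ → A =>
      (∑ k ∈ Finset.range m, if v k = a then (1 : ℝ) else 0) / m := by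
    funext v
    simp only [sampleFreq, Finset.card_filter]
    push_cast
    rfl
  rw [this]
  refine (Finset.measurable_sum _ fun k _ => ?_).div_const _
  have hk : MeasurableSet ((fun v : ℕ → A => v k) ⁻¹' {a}) :=
    measurable_pi_apply k (measurableSet_singleton a)
  exact Measurable.ite hk measurable_const measurable_const

/-- The moment generating function of a binomial variable, in multiplicative form. -/
lemma lintegral_rpow_sampleFreq [IsProbabilityMeasure μ] {V : ℕ → Ω → A}
    (hV : ∀ k, Measurable (V k)) (hind : iIndepFun V μ) {a : A} {p : ℝ} (hp : 0 ≤ p) (hp1 : p ≤ 1)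
    (hlaw : ∀ k, μ.real {ω | V k ω = a} = p) {t : ℝ} (ht : 0 < t) (c : ℝ) (m : ℕ) :
    ∫⁻ ω, ENNReal.ofReal (t ^ (c * sampleFreq a m fun k => V k ω)) ∂μ =
      ENNReal.ofReal ((1 - p + p * t ^ (c / m)) ^ m) := by
  classical
  set s : ℝ := t ^ (c / m) with hs
  have hspos : 0 < s := Real.rpow_pos_of_pos ht _
  set φ : A → ENNReal := fun b => if b = a then ENNReal.ofReal s else 1 with hφ
  have hφm : Measurable φ :=
    Measurable.ite (measurableSet_singleton a) measurable_const measurable_const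
  have h1 : ∀ ω, ENNReal.ofReal (t ^ (c * sampleFreq a m fun k => V k ω)) =
      ∏ k ∈ Finset.range m, φ (V k ω) := by
    intro ω
    rw [sampleFreq, mul_div_left_comm, mul_comm, Real.rpow_mul_natCast ht.le, ← hs,
      ENNReal.ofReal_pow hspos.le]
    simp only [hφ]
    rw [Finset.prod_ite, Finset.prod_const, Finset.prod_const_one, mul_one]
  have h2 : ∀ k, ∫⁻ ω, φ (V k ω) ∂μ = ENNReal.ofReal (1 - p + p * s) := by
    intro k
    have hE : MeasurableSet {ω | V k ω = a} := hV k (measurableSet_singleton a)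
    have hμ : μ {ω | V k ω = a} = ENNReal.ofReal p := by
      rw [← hlaw k, ofReal_measureReal]
    have : ∀ ω, φ (V k ω) = {ω | V k ω = a}.indicator (fun _ => ENNReal.ofReal s) ω +
        {ω | V k ω = a}ᶜ.indicator (fun _ => 1) ω := by
      intro ω
      by_cases hω : V k ω = a <;> simp [hφ, hω]
    simp_rw [this]
    rw [lintegral_add_left (measurable_const.indicator hE), lintegral_indicator_const hE,
      lintegral_indicator_const hE.compl, prob_compl_eq_one_sub hE, hμ, one_mul,
      ← ENNReal.ofReal_one, ← ENNReal.ofReal_sub _ hp, ← ENNReal.ofReal_mul hspos.le,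
      ← ENNReal.ofReal_add (by positivity) (by linarith)]
    congr 1
    ring
  simp_rw [h1]
  rw [lintegral_prod_eq_prod_lintegral_of_indepFun _ (fun k ω => φ (V k ω))
    (hind.comp (fun _ => φ) fun _ => hφm) fun k => hφm.comp (hV k)]
  simp_rw [h2]
  rw [Finset.prod_const, Finset.card_range, ENNReal.ofReal_pow]
  have : 0 ≤ 1 - p := by linarith
  positivity

/-- The one-step estimate: conditionally on a past that determines the sample size `N`, the reach
probability `M` and the weight `Y`, the average of `N ≥ M * C` samples, scaled by `M`, is dominated
by a binomial variable with `C * M` trials. -/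
lemma lintegral_sampling_step [IsProbabilityMeasure μ] {V : ℕ → Ω → A}
    (hV : ∀ k, Measurable (V k)) (hind : iIndepFun V μ) {a : A} {p : ℝ} (hp : 0 ≤ p) (hp1 : p ≤ 1)
    (hlaw : ∀ k, μ.real {ω | V k ω = a} = p) {t : ℝ} (ht : 0 < t) {C : ℝ} (hC : 0 ≤ C)
    {N : Ω → ℕ} {M : Ω → ℝ} {Y : Ω → ENNReal}
    (hU : Measurable fun ω => (N ω, M ω, Y ω)) (hM : ∀ ω, 0 ≤ M ω)
    (hUV : IndepFun (fun ω => (N ω, M ω, Y ω)) (fun ω k => V k ω) μ) :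
    ∫⁻ ω, Y ω * (if M ω * C ≤ N ω then
        ENNReal.ofReal (t ^ (C * (M ω * sampleFreq a (N ω) fun k => V k ω))) else 0) ∂μ ≤
      ∫⁻ ω, Y ω * ENNReal.ofReal ((1 - p + p * t) ^ (C * M ω)) ∂μ := by
  set U : Ω → ℕ × ℝ × ENNReal := fun ω => (N ω, M ω, Y ω) with hUdef
  have hVm : Measurable fun ω k => V k ω := measurable_pi_iff.2 hV
  set f : (ℕ × ℝ × ENNReal) × (ℕ → A) → ENNReal := fun u =>
    u.1.2.2 * (if u.1.2.1 * C ≤ u.1.1 then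
      ENNReal.ofReal (t ^ (C * (u.1.2.1 * sampleFreq a u.1.1 u.2))) else 0) with hf
  have hfm : Measurable f := by
    have hN : Measurable fun u : (ℕ × ℝ × ENNReal) × (ℕ → A) => u.1.1 :=
      measurable_fst.comp measurable_fst
    have hx : Measurable fun u : (ℕ × ℝ × ENNReal) × (ℕ → A) => u.1.2.1 :=
      measurable_fst.comp (measurable_snd.comp measurable_fst)
    have hy : Measurable fun u : (ℕ × ℝ × ENNReal) × (ℕ → A) => u.1.2.2 :=
      measurable_snd.comp (measurable_snd.comp measurable_fst)
    have hfreq : Measurable fun u : (ℕ × ℝ × ENNReal) × (ℕ → A) => sampleFreq a u.1.1 u.2 :=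
      measurable_sampleFreq a hN measurable_snd
    have hcast : Measurable fun u : (ℕ × ℝ × ENNReal) × (ℕ → A) => (u.1.1 : ℝ) :=
      (measurable_from_top (f := fun k : ℕ => (k : ℝ))).comp hN
    exact hy.mul (Measurable.ite (measurableSet_le (hx.mul_const C) hcast)
      (measurable_const.pow ((hx.mul hfreq).const_mul C)).ennreal_ofReal measurable_const)
  have hjoint := (indepFun_iff_map_prod_eq_prod_map_map hU.aemeasurable hVm.aemeasurable).1 hUV
  have := Measure.isProbabilityMeasure_map (μ := μ) hVm.aemeasurable
  calc ∫⁻ ω, Y ω * (if M ω * C ≤ N ω then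
        ENNReal.ofReal (t ^ (C * (M ω * sampleFreq a (N ω) fun k => V k ω))) else 0) ∂μ
      = ∫⁻ ω, f (U ω, fun k => V k ω) ∂μ := rfl
    _ = ∫⁻ u, f u ∂(μ.map fun ω => (U ω, fun k => V k ω)) :=
        (lintegral_map hfm (hU.prodMk hVm)).symm
    _ = ∫⁻ u, ∫⁻ v, f (u, v) ∂(μ.map fun ω k => V k ω) ∂(μ.map U) := by
        rw [hjoint, lintegral_prod _ hfm.aemeasurable]
    _ = ∫⁻ ω, ∫⁻ ω', f (U ω, fun k => V k ω') ∂μ ∂μ := by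
        rw [lintegral_map hfm.lintegral_prod_right' hU]
        refine lintegral_congr fun ω => ?_
        exact lintegral_map (hfm.comp measurable_prodMk_left) hVm
    _ ≤ ∫⁻ ω, Y ω * ENNReal.ofReal ((1 - p + p * t) ^ (C * M ω)) ∂μ := by
        refine lintegral_mono fun ω => ?_
        simp only [hf, hUdef]
        split_ifs with hc
        · have hfreq : Measurable fun ω' => sampleFreq a (N ω) fun k => V k ω' :=
            measurable_sampleFreq a measurable_const hVm
          rw [lintegral_const_mul _ (measurable_const.pow
            ((hfreq.const_mul (M ω)).const_mul C)).ennreal_ofReal]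
          gcongr
          simp_rw [← mul_assoc]
          rw [lintegral_rpow_sampleFreq hV hind hp hp1 hlaw ht]
          exact ENNReal.ofReal_le_ofReal (bernoulli_pow_le_rpow hp hp1 ht hC (hM ω) hc)
        · simp

end OneNode

/-! ### Sampling along a path -/

namespace ExtensiveGame

variable {ι J A Ω : Type*}

/-- The σ-algebra generated by the samples at the nature nodes that are proper ancestors of `h`. -/
abbrev ancestorSamples [MeasurableSpace A] (G : ExtensiveGame ι J A) (X : List A → ℕ → Ω → A)
    (h : List A) : MeasurableSpace Ω :=
  ⨆ q : {g // G.IsNatureNode g ∧ g <:+ h ∧ g ≠ h} × ℕ,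
    MeasurableSpace.comap (X q.1 q.2) inferInstance

/-- The samples suffice on the path to `h`, with constant `C`: at every nature node that is a proper
ancestor of `h`, there are at least `C` times its empirical reach probability many. -/
def samplesSuffice (G : ExtensiveGame ι J A) (X : List A → ℕ → Ω → A) (n : List A → Ω → ℕ)
    (C : ℝ) : List A → Set Ω
  | [] => Set.univ
  | _ :: h => samplesSuffice G X n C h ∩
      {ω | G.player h = none → G.natureReach (empiricalNature X n ω) h * C ≤ n h ω}

lemma samplesSuffice_cons_some {G : ExtensiveGame ι J A} {h : List A} {i : ι}
    (hp : G.player h = some i) (X : List A → ℕ → Ω → A) (n : List A → Ω → ℕ) (C : ℝ) (a : A) :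
    G.samplesSuffice X n C (a :: h) = G.samplesSuffice X n C h := by
  simp [samplesSuffice, hp]

lemma samplesSuffice_cons_none {G : ExtensiveGame ι J A} {h : List A}
    (hp : G.player h = none) (X : List A → ℕ → Ω → A) (n : List A → Ω → ℕ) (C : ℝ) (a : A) :
    G.samplesSuffice X n C (a :: h) = G.samplesSuffice X n C h ∩
      {ω | G.natureReach (empiricalNature X n ω) h * C ≤ n h ω} := by
  simp [samplesSuffice, hp]

lemma mem_samplesSuffice {G : ExtensiveGame ι J A} {X : List A → ℕ → Ω → A} {n : List A → Ω → ℕ}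
    {C : ℝ} {ω : Ω} (hω : ∀ h, G.IsNatureNode h →
      G.natureReach (empiricalNature X n ω) h * C ≤ n h ω) {h : List A} (hh : h ∈ G.nodes) :
    ω ∈ G.samplesSuffice X n C h := by
  induction h with
  | nil => exact Set.mem_univ ω
  | cons a h ih =>
    exact ⟨ih (G.parent_mem a h hh), fun hp => hω h (isNatureNode_of_cons hh hp)⟩

lemma natureReach_empiricalNature_nonneg {G : ExtensiveGame ι J A} (X : List A → ℕ → Ω → A)
    (n : List A → Ω → ℕ) (ω : Ω) {h : List A} (hh : h ∈ G.nodes) :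
    0 ≤ G.natureReach (empiricalNature X n ω) h :=
  natureReach_nonneg (fun h a _ => empiricalNature_nonneg X n ω h a) hh

variable [MeasurableSpace A]

lemma ancestorSamples_le_cons (G : ExtensiveGame ι J A) (X : List A → ℕ → Ω → A)
    (a : A) (h : List A) : G.ancestorSamples X h ≤ G.ancestorSamples X (a :: h) := by
  refine iSup_le fun q => ?_
  have hne : q.1.1 ≠ a :: h := by
    intro e
    have := q.1.2.2.1.length_le
    rw [e] at this
    simp at this
  exact le_iSup_of_le (⟨⟨q.1.1, q.1.2.1, q.1.2.2.1.trans (List.suffix_cons a h), hne⟩, q.2⟩ :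
    {g // G.IsNatureNode g ∧ g <:+ (a :: h) ∧ g ≠ a :: h} × ℕ) le_rfl

lemma measurable_sample_ancestorSamples_cons {G : ExtensiveGame ι J A} {h : List A}
    (hh : G.IsNatureNode h) (X : List A → ℕ → Ω → A) (a : A) (k : ℕ) :
    Measurable[G.ancestorSamples X (a :: h)] (X h k) := by
  rw [measurable_iff_comap_le]
  exact le_iSup_of_le (⟨⟨h, hh, List.suffix_cons a h, by simp⟩, k⟩ :
    {g // G.IsNatureNode g ∧ g <:+ (a :: h) ∧ g ≠ a :: h} × ℕ) le_rfl

variable [MeasurableSpace Ω] {μ : Measure Ω}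
  {G : ExtensiveGame ι J A} {X : List A → ℕ → Ω → A} {n : List A → Ω → ℕ}

lemma IsNatureSampling.ancestorSamples_le (hX : G.IsNatureSampling μ X n) (h : List A) :
    G.ancestorSamples X h ≤ inferInstanceAs (MeasurableSpace Ω) :=
  iSup_le fun q => (hX.measurable q.1.1 q.1.2.1 q.2).comap_le

/-- The samples at a nature node are independent of those at its proper ancestors. -/
lemma IsNatureSampling.indep_ancestorSamples (hX : G.IsNatureSampling μ X n) {h : List A}
    (hh : G.IsNatureNode h) :
    Indep (G.ancestorSamples X h) (MeasurableSpace.comap (fun ω k => X h k ω) inferInstance) μ := by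
  set m : {h // G.IsNatureNode h} × ℕ → MeasurableSpace Ω := fun q =>
    MeasurableSpace.comap (X q.1 q.2) inferInstance with hm
  have hind : iIndep m μ := hX.indep
  have hle : ∀ q, m q ≤ inferInstanceAs (MeasurableSpace Ω) := fun q =>
    (hX.measurable q.1.1 q.1.2 q.2).comap_le
  have hdisj : Disjoint {q : {h // G.IsNatureNode h} × ℕ | q.1.1 ≠ h} {q | q.1.1 = h} :=
    Set.disjoint_left.2 fun q h1 h2 => h1 h2
  have key := indep_iSup_of_disjoint hle hind hdisj
  refine indep_of_indep_of_le_left (indep_of_indep_of_le_right key ?_) ?_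
  · change MeasurableSpace.comap _ (⨆ k, MeasurableSpace.comap (fun v : ℕ → A => v k) _) ≤ _
    rw [MeasurableSpace.comap_iSup]
    refine iSup_le fun k => ?_
    rw [MeasurableSpace.comap_comp]
    have hmem : ((⟨h, hh⟩, k) : {h // G.IsNatureNode h} × ℕ) ∈
        {q : {h // G.IsNatureNode h} × ℕ | q.1.1 = h} := by simp
    exact le_iSup₂ (f := fun q (_ : q ∈ {q : {h // G.IsNatureNode h} × ℕ | q.1.1 = h}) => m q)
      _ hmem
  · refine iSup_le fun q => ?_
    have hmem : ((⟨q.1.1, q.1.2.1⟩, q.2) : {h // G.IsNatureNode h} × ℕ) ∈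
        {q : {h // G.IsNatureNode h} × ℕ | q.1.1 ≠ h} := by simpa using q.1.2.2.2
    exact le_iSup₂ (f := fun q (_ : q ∈ {q : {h // G.IsNatureNode h} × ℕ | q.1.1 ≠ h}) => m q)
      _ hmem

/-- Nature's impossible moves are almost surely never sampled. -/
lemma IsNatureSampling.ae_natureReach_eq_zero (hX : G.IsNatureSampling μ X n)
    [IsProbabilityMeasure μ] {h : List A} (hh : h ∈ G.nodes)
    (h0 : G.natureReach G.nature h = 0) :
    ∀ᵐ ω ∂μ, G.natureReach (empiricalNature X n ω) h = 0 := by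
  induction h with
  | nil => exact absurd h0 one_ne_zero
  | cons a h ih =>
    have hpar := G.parent_mem a h hh
    cases hpl : G.player h with
    | some i =>
      simp only [natureReach_cons_some hpl] at h0 ⊢
      exact ih hpar h0
    | none =>
      simp only [natureReach_cons_none hpl] at h0 ⊢
      rcases mul_eq_zero.1 h0 with h1 | h1
      · filter_upwards [ih hpar h1] with ω hω
        rw [hω, zero_mul]
      · have hne : ∀ k, ∀ᵐ ω ∂μ, X h k ω ≠ a := by
          intro k
          have := hX.law h (isNatureNode_of_cons hh hpl) k a
          rw [h1, measureReal_eq_zero_iff] at this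
          rw [ae_iff]
          simpa using this
        filter_upwards [ae_all_iff.2 hne] with ω hω
        simp [empiricalNature, hω]

variable [MeasurableSingletonClass A]

lemma IsNatureSampling.measurable_natureReach (hX : G.IsNatureSampling μ X n) {h : List A}
    (hh : h ∈ G.nodes) : Measurable[G.ancestorSamples X h] fun ω =>
      G.natureReach (empiricalNature X n ω) h := by
  induction h with
  | nil => exact measurable_const
  | cons a h ih =>
    have ih := (ih (G.parent_mem a h hh)).mono (G.ancestorSamples_le_cons X a h) le_rfl
    cases hpl : G.player h with
    | some i => simpa only [natureReach_cons_some hpl] using ih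
    | none =>
      simp only [natureReach_cons_none hpl]
      have hn := isNatureNode_of_cons hh hpl
      have hsize : Measurable[G.ancestorSamples X (a :: h)] (n h) :=
        Measurable.mono (hX.size_measurable h hn) (G.ancestorSamples_le_cons X a h) le_rfl
      exact ih.mul (measurable_sampleFreq a hsize
        ((@measurable_pi_iff _ _ _ (G.ancestorSamples X (a :: h)) _ _).2 fun k =>
          measurable_sample_ancestorSamples_cons hn X a k))

lemma IsNatureSampling.measurableSet_reach_mul_le (hX : G.IsNatureSampling μ X n) {h : List A}
    (hh : G.IsNatureNode h) (C : ℝ) : MeasurableSet[G.ancestorSamples X h]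
      {ω | G.natureReach (empiricalNature X n ω) h * C ≤ n h ω} := by
  have hsize : Measurable[G.ancestorSamples X h] fun ω => (n h ω : ℝ) :=
    (measurable_from_top (f := fun k : ℕ => (k : ℝ))).comp (hX.size_measurable h hh)
  exact measurableSet_le ((hX.measurable_natureReach hh.1).mul_const C) hsize

lemma IsNatureSampling.measurableSet_samplesSuffice (hX : G.IsNatureSampling μ X n) {h : List A}
    (hh : h ∈ G.nodes) (C : ℝ) :
    MeasurableSet[G.ancestorSamples X h] (G.samplesSuffice X n C h) := by
  induction h with
  | nil => exact MeasurableSet.univ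
  | cons a h ih =>
    have hle := G.ancestorSamples_le_cons X a h
    have ih := hle _ (ih (G.parent_mem a h hh))
    cases hpl : G.player h with
    | some i => rwa [samplesSuffice_cons_some hpl]
    | none =>
      rw [samplesSuffice_cons_none hpl]
      exact ih.inter (hle _ (hX.measurableSet_reach_mul_le (isNatureNode_of_cons hh hpl) C))

/-- The empirical reach probability of `h`, restricted to the event that the samples suffice on the
path to `h`, is dominated by the average of `C` Bernoulli variables whose parameter is the true
reach probability. -/
lemma IsNatureSampling.lintegral_rpow_natureReach_le [IsProbabilityMeasure μ]
    (hX : G.IsNatureSampling μ X n) {C : ℝ} (hC : 0 ≤ C) {h : List A} (hh : h ∈ G.nodes) {t : ℝ}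
    (ht : 0 < t) :
    ∫⁻ ω, (G.samplesSuffice X n C h).indicator 1 ω *
        ENNReal.ofReal (t ^ (C * G.natureReach (empiricalNature X n ω) h)) ∂μ ≤
      ENNReal.ofReal ((1 - G.natureReach G.nature h + G.natureReach G.nature h * t) ^ C) := by
  induction h generalizing t with
  | nil => simp [samplesSuffice, natureReach, pathProd]
  | cons a h ih =>
    have hpar := G.parent_mem a h hh
    cases hpl : G.player h with
    | some i =>
      simp only [samplesSuffice_cons_some hpl, natureReach_cons_some hpl]
      exact ih hpar ht
    | none =>
      have hn := isNatureNode_of_cons hh hpl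
      have hp0 := hn.isDistributionOn.1 a
      have hp1 := hn.nature_le_one a
      have ht' : 0 < 1 - G.nature h a + G.nature h a * t := by
        rcases hp0.eq_or_lt' with e | e
        · simp [e]
        · have := mul_pos e ht
          linarith
      have hle := hX.ancestorSamples_le h
      have hU : Measurable[G.ancestorSamples X h] fun ω =>
          (n h ω, G.natureReach (empiricalNature X n ω) h,
            (G.samplesSuffice X n C h).indicator (1 : Ω → ENNReal) ω) :=
        Measurable.prodMk (hX.size_measurable h hn) (Measurable.prodMk
          (hX.measurable_natureReach hpar)
          (measurable_const.indicator (hX.measurableSet_samplesSuffice hpar C)))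
      have hind : iIndepFun (X h) μ :=
        hX.indep.precomp (g := fun k => (⟨⟨h, hn⟩, k⟩ : {h // G.IsNatureNode h} × ℕ))
          fun k l e => (Prod.ext_iff.1 e).2
      have step := lintegral_sampling_step (hX.measurable h hn) hind hp0 hp1
        (fun k => hX.law h hn k a) ht hC (hU.mono hle le_rfl)
        (fun ω => natureReach_empiricalNature_nonneg X n ω hpar)
        (indep_of_indep_of_le_left (hX.indep_ancestorSamples hn) hU.comap_le)
      calc ∫⁻ ω, (G.samplesSuffice X n C (a :: h)).indicator 1 ω *
            ENNReal.ofReal (t ^ (C * G.natureReach (empiricalNature X n ω) (a :: h))) ∂μ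
          ≤ ∫⁻ ω, (G.samplesSuffice X n C h).indicator 1 ω * ENNReal.ofReal
              ((1 - G.nature h a + G.nature h a * t) ^
                (C * G.natureReach (empiricalNature X n ω) h)) ∂μ := by
            refine le_trans (le_of_eq (lintegral_congr fun ω => ?_)) step
            rw [samplesSuffice_cons_none hpl, natureReach_cons_none hpl,
              empiricalNature_eq_sampleFreq]
            by_cases h1 : ω ∈ G.samplesSuffice X n C h <;>
            by_cases h2 : G.natureReach (empiricalNature X n ω) h * C ≤ n h ω <;>
            simp [h1, h2]
        _ ≤ _ := ih hpar ht'
        _ = _ := by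
            rw [natureReach_cons_none hpl]
            congr 2
            ring

/-- The Chernoff bound, for both tails (`s = 1` and `s = -1`). -/
lemma IsNatureSampling.measure_tail_le [IsProbabilityMeasure μ] (hX : G.IsNatureSampling μ X n)
    {C : ℝ} (hC : 0 < C) {h : List A} (hh : h ∈ G.nodes) {r : ℝ} (hr : 0 ≤ r) {s : ℝ}
    (hs : s ^ 2 = 1) :
    μ {ω | ω ∈ G.samplesSuffice X n C h ∧
        r ≤ s * (G.natureReach (empiricalNature X n ω) h - G.natureReach G.nature h)} ≤
      ENNReal.ofReal (Real.exp (-(2 * C * r ^ 2))) := by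
  set ρ := G.natureReach G.nature h with hρ
  have hρ0 : 0 ≤ ρ := natureReach_nonneg (fun h a hh => hh.isDistributionOn.1 a) hh
  have hρ1 : ρ ≤ 1 := natureReach_le_one hh
  -- The minimizer of the exponent `l ^ 2 / (8 * C) - l * r`, with the sign of the tail.
  set l : ℝ := 4 * C * r * s with hl
  have hle := hX.ancestorSamples_le h
  have hmain := hX.lintegral_rpow_natureReach_le hC.le hh (Real.exp_pos (l / C))
  set f : Ω → ENNReal := fun ω => (G.samplesSuffice X n C h).indicator 1 ω *
    ENNReal.ofReal (Real.exp (l / C) ^ (C * G.natureReach (empiricalNature X n ω) h)) with hf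
  have hfm : Measurable f := by
    refine Measurable.mul (measurable_const.indicator
      (hle _ (hX.measurableSet_samplesSuffice hh C))) ?_
    exact (measurable_const.pow
      (((hX.measurable_natureReach hh).mono hle le_rfl).const_mul C)).ennreal_ofReal
  have hbound : ∫⁻ ω, f ω ∂μ ≤ ENNReal.ofReal (Real.exp (l * ρ + 2 * C * r ^ 2)) := by
    refine hmain.trans (ENNReal.ofReal_le_ofReal ?_)
    have hb := bernoulli_mgf_le hρ0 hρ1 (l / C)
    have h0 : 0 ≤ 1 - ρ + ρ * Real.exp (l / C) := by
      have := mul_nonneg hρ0 (Real.exp_pos (l / C)).le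
      linarith
    refine (Real.rpow_le_rpow h0 hb hC.le).trans (le_of_eq ?_)
    rw [← Real.exp_mul]
    congr 1
    have : l ^ 2 = 16 * C ^ 2 * r ^ 2 := by
      rw [hl, mul_pow, hs]
      ring
    rw [div_pow, this]
    field_simp
    ring
  set c : ENNReal := ENNReal.ofReal (Real.exp (l * ρ + 4 * C * r ^ 2)) with hc
  have hc0 : c ≠ 0 := by
    rw [hc, Ne, ENNReal.ofReal_eq_zero, not_le]
    exact Real.exp_pos _
  calc μ {ω | ω ∈ G.samplesSuffice X n C h ∧
        r ≤ s * (G.natureReach (empiricalNature X n ω) h - ρ)}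
      ≤ μ {ω | c ≤ f ω} := by
        refine measure_mono fun ω hω => ?_
        obtain ⟨h1, h2⟩ := hω
        simp only [Set.mem_ofPred_eq, hf, hc, Set.indicator_of_mem h1, Pi.one_apply, one_mul]
        refine ENNReal.ofReal_le_ofReal ?_
        rw [← Real.exp_mul, Real.exp_le_exp]
        have h3 : l / C * (C * G.natureReach (empiricalNature X n ω) h) =
            l * G.natureReach (empiricalNature X n ω) h := by
          field_simp
        have h4 := mul_le_mul_of_nonneg_left h2 (by positivity : 0 ≤ 4 * C * r)
        rw [h3, hl]
        linarith
    _ ≤ (∫⁻ ω, f ω ∂μ) / c := meas_ge_le_lintegral_div hfm.aemeasurable hc0 ENNReal.ofReal_ne_top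
    _ ≤ ENNReal.ofReal (Real.exp (l * ρ + 2 * C * r ^ 2)) / c := by gcongr
    _ = ENNReal.ofReal (Real.exp (-(2 * C * r ^ 2))) := by
        rw [hc, ← ENNReal.ofReal_div_of_pos (Real.exp_pos _), ← Real.exp_sub]
        congr 2
        ring

/-- Hoeffding's inequality for the empirical reach probability. -/
lemma IsNatureSampling.measure_abs_ge_le [IsProbabilityMeasure μ] (hX : G.IsNatureSampling μ X n)
    {C : ℝ} (hC : 0 < C) {h : List A} (hh : h ∈ G.nodes) {r : ℝ} (hr : 0 ≤ r) :
    μ {ω | ω ∈ G.samplesSuffice X n C h ∧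
        r ≤ |G.natureReach G.nature h - G.natureReach (empiricalNature X n ω) h|} ≤
      ENNReal.ofReal (2 * Real.exp (-(2 * C * r ^ 2))) := by
  rw [two_mul, ENNReal.ofReal_add (Real.exp_pos _).le (Real.exp_pos _).le]
  refine le_trans ((measure_mono fun ω hω => ?_).trans (measure_union_le _ _))
    (add_le_add (hX.measure_tail_le hC hh hr (s := 1) (by norm_num))
      (hX.measure_tail_le hC hh hr (s := -1) (by norm_num)))
  obtain ⟨h1, h2⟩ := hω
  rcases le_abs.1 h2 with h3 | h3
  · exact Or.inr ⟨h1, by linarith⟩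
  · exact Or.inl ⟨h1, by linarith⟩

end ExtensiveGame

/-! ### Union bound over the terminal nodes -/

theorem mainTheorem7 {ι J A : Type*} [MeasurableSpace A] [MeasurableSingletonClass A]
    (G : ExtensiveGame ι J A) (i : ι)
    (B : ℝ) (hB : ∀ z ∈ G.terminals, |G.utility i z| ≤ B)
    {Ω : Type*} [MeasurableSpace Ω] (μ : Measure Ω) [IsProbabilityMeasure μ]
    (X : List A → ℕ → Ω → A) (n : List A → Ω → ℕ) (hX : G.IsNatureSampling μ X n)
    (ε δ : ℝ) (hε : 0 < ε) (hδ : 0 < δ) :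
    ENNReal.ofReal (1 - δ) ≤
      μ {ω |
        (∀ h, G.IsNatureNode h →
          G.natureReach (empiricalNature X n ω) h *
              ((B ^ 2 * (G.maxSupport : ℝ) ^ 2 / (2 * ε ^ 2)) *
                Real.log (2 * (G.nodes.card : ℝ) / δ)) ≤ (n h ω : ℝ)) →
        ∀ σ : ι → J → A → ℝ, G.IsProfile σ →
          |G.value G.nature i σ - G.value (empiricalNature X n ω) i σ| ≤ ε} := by
  rcases le_or_gt 1 δ with hδ1 | hδ1
  · rw [ENNReal.ofReal_of_nonpos (by linarith)]
    exact zero_le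
  set C : ℝ := (B ^ 2 * (G.maxSupport : ℝ) ^ 2 / (2 * ε ^ 2)) *
    Real.log (2 * (G.nodes.card : ℝ) / δ) with hC
  set T : Set Ω := {ω | (∀ h, G.IsNatureNode h →
      G.natureReach (empiricalNature X n ω) h * C ≤ (n h ω : ℝ)) →
    ∀ σ : ι → J → A → ℝ, G.IsProfile σ →
      |G.value G.nature i σ - G.value (empiricalNature X n ω) i σ| ≤ ε} with hT
  suffices hbad : μ Tᶜ ≤ ENNReal.ofReal δ by
    rw [ENNReal.ofReal_sub _ hδ.le, ENNReal.ofReal_one, tsub_le_iff_right,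
      ← measure_univ (μ := μ), ← Set.union_compl_self T]
    exact (measure_union_le _ _).trans (by gcongr)
  have hnull : ∀ᵐ ω ∂μ, ∀ z ∈ G.terminals, G.natureReach G.nature z = 0 →
      G.natureReach (empiricalNature X n ω) z = 0 := by
    rw [Finset.eventually_all]
    intro z hz
    by_cases h0 : G.natureReach G.nature z = 0
    · filter_upwards [hX.ae_natureReach_eq_zero (ExtensiveGame.mem_terminals.1 hz).1 h0] with ω hω _
      exact hω
    · exact Filter.Eventually.of_forall fun _ h => absurd h h0
  have hnonneg : ∀ σ : ι → J → A → ℝ, G.IsProfile σ → ∀ z ∈ G.terminals,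
      0 ≤ G.reachProb G.natureSupport σ z := fun σ hσ z hz =>
    ExtensiveGame.reachProb_nonneg (fun h a _ => G.natureSupport_nonneg h a) hσ
      (ExtensiveGame.mem_terminals.1 hz).1
  rcases le_or_gt (B * (G.maxSupport : ℝ)) 0 with hBD | hBD
  · -- Payoff times weight vanishes at every terminal node, so both values agree almost surely.
    have hT1 : ∀ᵐ ω ∂μ, ω ∈ T := by
      filter_upwards [hnull] with ω hω _ σ hσ
      refine (ExtensiveGame.abs_value_sub_value_le hσ i hω).trans
        (le_trans (le_of_eq (Finset.sum_eq_zero fun z hz => ?_)) hε.le)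
      have hS := ExtensiveGame.sum_reachProb_natureSupport_le_maxSupport hσ
      have h1 := (Finset.single_le_sum (hnonneg σ hσ) hz).trans hS
      have h2 := mul_le_mul (hB z hz) h1 (hnonneg σ hσ z hz) ((abs_nonneg _).trans (hB z hz))
      have h3 := mul_nonneg (abs_nonneg (G.utility i z)) (hnonneg σ hσ z hz)
      rw [mul_assoc, le_antisymm (h2.trans hBD) h3, mul_zero]
    have hzero : μ Tᶜ = 0 := mem_ae_iff.1 (by simpa using hT1)
    rw [hzero]
    exact zero_le
  set r : ℝ := ε / (B * G.maxSupport) with hr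
  have hrpos : 0 < r := div_pos hε hBD
  have hN : (1 : ℝ) ≤ G.nodes.card := by
    exact_mod_cast Finset.card_pos.2 ⟨_, G.root_mem⟩
  have hlog : 0 < Real.log (2 * (G.nodes.card : ℝ) / δ) := by
    refine Real.log_pos ?_
    rw [lt_div_iff₀ hδ]
    linarith
  -- The constant `C` is chosen so that Hoeffding's bound at deviation `r` equals `δ / N`.
  have hCr : 2 * C * r ^ 2 = Real.log (2 * (G.nodes.card : ℝ) / δ) := by
    have hB0 : B ≠ 0 := left_ne_zero_of_mul hBD.ne'
    have hD0 : (G.maxSupport : ℝ) ≠ 0 := right_ne_zero_of_mul hBD.ne'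
    rw [hC, hr]
    field_simp
  have hCpos : 0 < C := by
    have h1 : 0 < C * (2 * r ^ 2) := by linarith
    exact pos_of_mul_pos_left h1 (by positivity)
  have htail : ∀ z ∈ G.terminals, μ {ω | ω ∈ G.samplesSuffice X n C z ∧
      r ≤ |G.natureReach G.nature z - G.natureReach (empiricalNature X n ω) z|} ≤
        ENNReal.ofReal (δ / G.nodes.card) := by
    intro z hz
    refine (hX.measure_abs_ge_le hCpos (ExtensiveGame.mem_terminals.1 hz).1 hrpos.le).trans
      (le_of_eq ?_)
    rw [hCr, Real.exp_neg, Real.exp_log (by positivity), inv_div]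
    congr 1
    field_simp
  have hsub : Tᶜ ⊆ {ω | ¬ ∀ z ∈ G.terminals, G.natureReach G.nature z = 0 →
        G.natureReach (empiricalNature X n ω) z = 0} ∪
      ⋃ z ∈ G.terminals, {ω | ω ∈ G.samplesSuffice X n C z ∧
        r ≤ |G.natureReach G.nature z - G.natureReach (empiricalNature X n ω) z|} := by
    intro ω hω
    by_contra hgood
    simp only [Set.mem_union, Set.mem_ofPred_eq, Set.mem_iUnion, not_or, not_not, not_exists,
      not_and, not_le] at hgood
    obtain ⟨hω0, hdev⟩ := hgood
    refine hω fun hsize σ hσ => (ExtensiveGame.abs_value_sub_value_le hσ i hω0).trans ?_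
    have hD0 : 0 < (G.maxSupport : ℝ) :=
      lt_of_le_of_ne (Nat.cast_nonneg _) (right_ne_zero_of_mul hBD.ne').symm
    have hB0 : 0 < B := pos_of_mul_pos_left hBD hD0.le
    calc ∑ z ∈ G.terminals, |G.natureReach G.nature z -
            G.natureReach (empiricalNature X n ω) z| * |G.utility i z| *
              G.reachProb G.natureSupport σ z
        ≤ ∑ z ∈ G.terminals, r * B * G.reachProb G.natureSupport σ z := by
          refine Finset.sum_le_sum fun z hz => mul_le_mul_of_nonneg_right ?_ (hnonneg σ hσ z hz)
          exact mul_le_mul (hdev z hz (ExtensiveGame.mem_samplesSuffice hsize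
            (ExtensiveGame.mem_terminals.1 hz).1)).le (hB z hz) (abs_nonneg _) hrpos.le
      _ ≤ r * B * G.maxSupport := by
          rw [← Finset.mul_sum]
          exact mul_le_mul_of_nonneg_left
            (ExtensiveGame.sum_reachProb_natureSupport_le_maxSupport hσ) (by positivity)
      _ = ε := by
          rw [mul_assoc, hr, div_mul_cancel₀ _ hBD.ne']
  refine (measure_mono hsub).trans ((measure_union_le _ _).trans ?_)
  rw [ae_iff.1 hnull, zero_add]
  calc μ (⋃ z ∈ G.terminals, {ω | ω ∈ G.samplesSuffice X n C z ∧
        r ≤ |G.natureReach G.nature z - G.natureReach (empiricalNature X n ω) z|})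
      ≤ ∑ z ∈ G.terminals, ENNReal.ofReal (δ / G.nodes.card) :=
        (measure_biUnion_finset_le _ _).trans (Finset.sum_le_sum htail)
    _ = ENNReal.ofReal (G.terminals.card * (δ / G.nodes.card)) := by
        rw [Finset.sum_const, nsmul_eq_mul, ENNReal.ofReal_mul (Nat.cast_nonneg _),
          ENNReal.ofReal_natCast]
    _ ≤ ENNReal.ofReal δ := by
        refine ENNReal.ofReal_le_ofReal ?_
        have hcard : (G.terminals.card : ℝ) ≤ G.nodes.card := by
          exact_mod_cast Finset.card_le_card fun z hz => (ExtensiveGame.mem_terminals.1 hz).1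
        rw [← mul_div_assoc, div_le_iff₀ (by linarith), mul_comm δ]
        gcongr
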